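/- **Extended Mayers–Yao self-test.** Let $X,Y,Z$ be the Pauli matrices and $|\phi_+\rangle=\frac{1}{\sqrt2}(|00\rangle+|11\rangle)$. In the reference experiment Alice and Bob share $|\phi_+\rangle$ and each measures one of six $\pm1$-valued observables. Alice's are $$X_A=X,\quad Y_A=Y,\quad Z_A=Z,\quad D_A=\tfrac{X+Z}{\sqrt2},\quad E_A=\tfrac{X+Y}{\sqrt2},\quad F_A=\tfrac{Y+Z}{\sqrt2},$$ and Bob's are $$X_B=X,\quad Y_B=-Y,\quad Z_B=Z,\quad D_B=\tfrac{X+Z}{\sqrt2},\quad E_B=\tfrac{X-Y}{\sqrt2},\quad F_B=\tfrac{Z-Y}{\sqrt2}.$$ A physical experiment consists of complex Hilbert spaces $\mathcal H_A,\mathcal H_B$ of arbitrary dimension, a unit vector $|\psi'\rangle\in\mathcal H_A\otimes\mathcal H_B$, and, for each $M\in\{X,Y,Z,D,E,F\}$, Hermitian observables $M'_A$ on $\mathcal H_A$ and $M'_B$ on $\mathcal H_B$ with $(M'_A)^2=I$ and $(M'_B)^2=I$. Suppose it reproduces the statistics of the three Mayers–Yao tests with settings $\{X,Z,D\}$, $\{X,Y,E\}$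 and $\{Y,Z,F\}$: for each of these three sets and all settings $M,N$ in it, the joint distribution of the outcomes when Alice measures $M$ and Bob measures $N$ is the same as in the reference experiment. Then the physical experiment is equivalent to a general simulation of the reference experiment, in the following sense. For a $2\times2$ matrix $M$ with entrywise complex conjugate $M^*$ put $C(M)=|0\rangle\langle0|\otimes M+|1\rangle\langle1|\otimes M^*$ on $\mathbb C^2_P\otimes\mathbb C^2_Q$, where $P$ is an extra qubit; thus $C(X)=I\otimes X$, $C(Z)=I\otimes Z$ and $C(Y)=Z\otimes Y$. There are isometries $\Phi_A:\mathcal H_A\to\mathcal H_A\otimes\mathbb C^2_{P_A}\otimes\mathbb C^2_{Q_A}$ and $\Phi_B:\mathcal H_B\to\mathcal H_B\otimes\mathbb C^2_{P_B}\otimes\mathbb C^2_{Q_B}$, numbers $\alpha,\beta\in\mathbb C$ with $|\alpha|^2+|\beta|^2=1$, and unit vectors $|\theta_{00}\rangle,|\theta_{11}\rangle\in\mathcal H_A\otimes\mathcal H_B$ (not necessarily orthogonal) such that, with $\Phi=\Phi_A\otimes\Phi_B$ and $$|\Psi\rangle=|\phi_+\rangle_{Q_AQ_B}\otimes\bigl(\alpha\,|00\rangle_{P_AP_B}|\theta_{00}\rangle+\beta\,|11\rangle_{P_AP_B}|\theta_{11}\rangle\bigr),$$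 we have $\Phi|\psi'\rangle=|\Psi\rangle$ and, for every $M\in\{X,Y,Z,D,E,F\}$, $$\Phi\,(M'_A\otimes I)|\psi'\rangle=C(M_A)_{P_AQ_A}|\Psi\rangle,\qquad \Phi\,(I\otimes M'_B)|\psi'\rangle=C(M_B)_{P_BQ_B}|\Psi\rangle .$$ -/

import Mathlib

open scoped TensorProduct Kronecker ComplexConjugate

noncomputable section

namespace SelfTest

/-! ### Bipartite Hilbert spaces and local operators -/

/-- The Hilbert space of a bipartite system: the completed tensor product of two (possibly
infinite-dimensional) complex inner product spaces. -/
abbrev Bipartite (E F : Type*) [NormedAddCommGroup E] [InnerProductSpace ℂ E]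
    [NormedAddCommGroup F] [InnerProductSpace ℂ F] : Type _ :=
  UniformSpace.Completion (E ⊗[ℂ] F)

section Local

variable {E F E' F' : Type*}
  [NormedAddCommGroup E] [InnerProductSpace ℂ E] [NormedAddCommGroup F] [InnerProductSpace ℂ F]
  [NormedAddCommGroup E'] [InnerProductSpace ℂ E'] [NormedAddCommGroup F'] [InnerProductSpace ℂ F']

/-- The local operator `f ⊗ g` on bipartite Hilbert spaces, for bounded `f` and `g`. -/
def localOp (f : E →L[ℂ] E') (g : F →L[ℂ] F') : Bipartite E F →L[ℂ] Bipartite E' F' :=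
  (TensorProduct.mapL f g).completion

end Local

/-! ### Physical experiments -/

/-- A bipartite physical experiment with settings labelled by `S` on each side: a pure state of
`HA ⊗ HB` and, for every setting of either party, a Hermitian observable on that party's space with
outcomes `+1` and `-1`. -/
structure Experiment (S : Type*) (HA HB : Type*)
    [NormedAddCommGroup HA] [InnerProductSpace ℂ HA] [CompleteSpace HA]
    [NormedAddCommGroup HB] [InnerProductSpace ℂ HB] [CompleteSpace HB] where
  state : Bipartite HA HB
  norm_state : ‖state‖ = 1
  obsA : S → (HA →L[ℂ] HA)
  obsB : S → (HB →L[ℂ] HB)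
  selfAdjoint_obsA : ∀ a, IsSelfAdjoint (obsA a)
  selfAdjoint_obsB : ∀ b, IsSelfAdjoint (obsB b)
  sq_obsA : ∀ a, obsA a * obsA a = 1
  sq_obsB : ∀ b, obsB b * obsB b = 1

/-- The projection `(1 + x M) / 2` onto the eigenspace of outcome `x = ±1` of the observable `M`. -/
def outcomeProj {A : Type*} [Ring A] [Algebra ℂ A] (M : A) (x : ℤˣ) : A :=
  (1 / 2 : ℂ) • (1 + ((x : ℤ) : ℂ) • M)

section Experiment

variable {S HA HB : Type*}
  [NormedAddCommGroup HA] [InnerProductSpace ℂ HA] [CompleteSpace HA]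
  [NormedAddCommGroup HB] [InnerProductSpace ℂ HB] [CompleteSpace HB]

/-- The probability that the parties obtain the outcomes `x`, `y`, given the settings `a`, `b`. -/
def Experiment.prob (P : Experiment S HA HB) (a b : S) (x y : ℤˣ) : ℝ :=
  (inner ℂ P.state
    (localOp (outcomeProj (P.obsA a) x) (outcomeProj (P.obsB b) y) P.state)).re

end Experiment

/-! ### Reference experiments -/

/-- A bipartite reference experiment on `ℂ^m ⊗ ℂ^n` with its computational basis: the amplitudes of
the state and the matrices of the `±1`-valued observables. -/
structure RefExperiment (S : Type*) (m n : Type*) [Fintype m] [DecidableEq m]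
    [Fintype n] [DecidableEq n] where
  state : m × n → ℂ
  norm_state : ∑ p, ‖state p‖ ^ 2 = 1
  obsA : S → Matrix m m ℂ
  obsB : S → Matrix n n ℂ
  hermitian_obsA : ∀ a, (obsA a).IsHermitian
  hermitian_obsB : ∀ b, (obsB b).IsHermitian
  sq_obsA : ∀ a, obsA a * obsA a = 1
  sq_obsB : ∀ b, obsB b * obsB b = 1

section Reference

variable {S m n : Type*} [Fintype m] [DecidableEq m] [Fintype n] [DecidableEq n]

/-- The probability of the outcomes `x`, `y`, given the settings `a`, `b`. -/
def RefExperiment.prob (R : RefExperiment S m n) (a b : S) (x y : ℤˣ) : ℝ :=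
  (star R.state ⬝ᵥ
    (outcomeProj (R.obsA a) x ⊗ₖ outcomeProj (R.obsB b) y).mulVec R.state).re

/-! ### General simulations

Each party gets one extra qubit (the first factor of `Fin 2 × m`, resp. `Fin 2 × n`), which says
whether to perform the reference experiment (`0`) or its complex conjugate (`1`). -/

/-- `C(M) = |0⟩⟨0| ⊗ M + |1⟩⟨1| ⊗ M*`, with `M*` the entrywise complex conjugate. -/
def simOp (M : Matrix m m ℂ) : Matrix (Fin 2 × m) (Fin 2 × m) ℂ :=
  Matrix.single 0 0 1 ⊗ₖ M + Matrix.single 1 1 1 ⊗ₖ M.map conj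

/-- The branch `|00⟩ ⊗ |ψ⟩`. -/
def RefExperiment.branch₀ (R : RefExperiment S m n) : (Fin 2 × m) × (Fin 2 × n) → ℂ :=
  fun p => if p.1.1 = 0 ∧ p.2.1 = 0 then R.state (p.1.2, p.2.2) else 0

/-- The branch `|11⟩ ⊗ |ψ*⟩`. -/
def RefExperiment.branch₁ (R : RefExperiment S m n) : (Fin 2 × m) × (Fin 2 × n) → ℂ :=
  fun p => if p.1.1 = 1 ∧ p.2.1 = 1 then conj (R.state (p.1.2, p.2.2)) else 0

end Reference

/-! ### Equivalence with a general simulation -/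

section Equivalence

variable {S HA HB m n k l : Type*}
  [NormedAddCommGroup HA] [InnerProductSpace ℂ HA] [CompleteSpace HA]
  [NormedAddCommGroup HB] [InnerProductSpace ℂ HB] [CompleteSpace HB]
  [Fintype m] [DecidableEq m] [Fintype n] [DecidableEq n]
  [Fintype k] [DecidableEq k] [Fintype l] [DecidableEq l]

/-- The map `h ↦ h ⊗ |i⟩`, which attaches a register in the computational basis state `i`. -/
def attach (H : Type*) [NormedAddCommGroup H] [InnerProductSpace ℂ H] (i : k) :
    H →L[ℂ] H ⊗[ℂ] EuclideanSpace ℂ k :=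
  (TensorProduct.mkL ℂ H (EuclideanSpace ℂ k)).flip (EuclideanSpace.single i 1)

/-- The product state `|θ⟩ ⊗ |ξ⟩`, for `θ` in `HA ⊗ HB` and `ξ = ∑ ξ i j |i⟩|j⟩` in `ℂ^k ⊗ ℂ^l`, as an
element of `(HA ⊗ ℂ^k) ⊗ (HB ⊗ ℂ^l)`: the tensor factors are regrouped by party. -/
def junkTensor (θ : Bipartite HA HB) (ξ : k × l → ℂ) :
    Bipartite (HA ⊗[ℂ] EuclideanSpace ℂ k) (HB ⊗[ℂ] EuclideanSpace ℂ l) :=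
  ∑ i, ∑ j, ξ (i, j) • localOp (attach HA i) (attach HB j) θ

/-- The vector `α |θ₀⟩ ⊗ L (|00⟩|ψ⟩) + β |θ₁⟩ ⊗ L (|11⟩|ψ*⟩)`. For `L = 1` this is a general simulation of
the reference state `ψ`, together with ancillas in the states `θ₀`, `θ₁`; tracing out the ancillas
gives an arbitrary, coherent or incoherent, mixture of `ψ` and `ψ*`. For other `L` it is the result
of applying the operator `L` to the simulation registers. -/
def simVector (R : RefExperiment S m n) (α β : ℂ) (θ₀ θ₁ : Bipartite HA HB)
    (L : Matrix ((Fin 2 × m) × (Fin 2 × n)) ((Fin 2 × m) × (Fin 2 × n)) ℂ) :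
    Bipartite (HA ⊗[ℂ] EuclideanSpace ℂ (Fin 2 × m)) (HB ⊗[ℂ] EuclideanSpace ℂ (Fin 2 × n)) :=
  α • junkTensor θ₀ (L.mulVec R.branch₀) + β • junkTensor θ₁ (L.mulVec R.branch₁)

/-- The physical experiment `P` is equivalent to a general simulation of the reference experiment
`R`: a local isometry `ΦA ⊗ ΦB`, with `ΦA : HA → HA ⊗ (ℂ² ⊗ ℂ^m)` and `ΦB : HB → HB ⊗ (ℂ² ⊗ ℂ^n)`, takes
the physical state to a simulation state and the action of every physical observable on the state to
the action of the simulated observable. -/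
def EquivToGeneralSimulation (P : Experiment S HA HB) (R : RefExperiment S m n) : Prop :=
  ∃ (ΦA : HA →ₗᵢ[ℂ] HA ⊗[ℂ] EuclideanSpace ℂ (Fin 2 × m))
    (ΦB : HB →ₗᵢ[ℂ] HB ⊗[ℂ] EuclideanSpace ℂ (Fin 2 × n))
    (α β : ℂ) (θ₀ θ₁ : Bipartite HA HB),
    ‖α‖ ^ 2 + ‖β‖ ^ 2 = 1 ∧ ‖θ₀‖ = 1 ∧ ‖θ₁‖ = 1 ∧
    localOp ΦA.toContinuousLinearMap ΦB.toContinuousLinearMap P.state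
      = simVector R α β θ₀ θ₁ 1 ∧
    (∀ a, localOp ΦA.toContinuousLinearMap ΦB.toContinuousLinearMap
        (localOp (P.obsA a) 1 P.state)
      = simVector R α β θ₀ θ₁ (simOp (R.obsA a) ⊗ₖ 1)) ∧
    (∀ b, localOp ΦA.toContinuousLinearMap ΦB.toContinuousLinearMap
        (localOp 1 (P.obsB b) P.state)
      = simVector R α β θ₀ θ₁ (1 ⊗ₖ simOp (R.obsB b)))

end Equivalence

/-! ### The extended Mayers–Yao test -/

/-- The six measurement settings of either party. -/
inductive Setting
  | X | Y | Z | D | E | F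
  deriving DecidableEq

/-- The settings used in each of the three Mayers–Yao tests. -/
def testSettings : Fin 3 → Finset Setting :=
  ![{.X, .Z, .D}, {.X, .Y, .E}, {.Y, .Z, .F}]

def pauliX : Matrix (Fin 2) (Fin 2) ℂ := !![0, 1; 1, 0]

def pauliY : Matrix (Fin 2) (Fin 2) ℂ := !![0, -Complex.I; Complex.I, 0]

def pauliZ : Matrix (Fin 2) (Fin 2) ℂ := !![1, 0; 0, -1]

/-- Alice's reference observables. -/
def refObsA : Setting → Matrix (Fin 2) (Fin 2) ℂ
  | .X => pauliX
  | .Y => pauliY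
  | .Z => pauliZ
  | .D => ((1 / √2 : ℝ) : ℂ) • (pauliX + pauliZ)
  | .E => ((1 / √2 : ℝ) : ℂ) • (pauliX + pauliY)
  | .F => ((1 / √2 : ℝ) : ℂ) • (pauliY + pauliZ)

/-- Bob's reference observables; his `Y` carries the opposite sign. -/
def refObsB : Setting → Matrix (Fin 2) (Fin 2) ℂ
  | .X => pauliX
  | .Y => -pauliY
  | .Z => pauliZ
  | .D => ((1 / √2 : ℝ) : ℂ) • (pauliX + pauliZ)
  | .E => ((1 / √2 : ℝ) : ℂ) • (pauliX - pauliY)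
  | .F => ((1 / √2 : ℝ) : ℂ) • (pauliZ - pauliY)

/-- The amplitudes of `|φ₊⟩ = (|00⟩ + |11⟩) / √2`. -/
def phiPlus : Fin 2 × Fin 2 → ℂ :=
  fun p => if p.1 = p.2 then ((1 / √2 : ℝ) : ℂ) else 0

theorem inv_sqrt_two_mul_self : ((1 / √2 : ℝ) : ℂ) * ((1 / √2 : ℝ) : ℂ) = 1 / 2 := by
  rw [← Complex.ofReal_mul, div_mul_div_comm, Real.mul_self_sqrt (by norm_num)]
  norm_num

/-- The reference experiment of the extended Mayers–Yao test. -/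
def extMayersYao : RefExperiment Setting (Fin 2) (Fin 2) where
  state := phiPlus
  norm_state := by
    simp [Fintype.sum_prod_type, phiPlus]
    norm_num
  obsA := refObsA
  obsB := refObsB
  hermitian_obsA a := by
    cases a <;> ext i j <;> fin_cases i <;> fin_cases j <;>
      simp [refObsA, pauliX, pauliY, pauliZ]
  hermitian_obsB b := by
    cases b <;> ext i j <;> fin_cases i <;> fin_cases j <;>
      simp [refObsB, pauliX, pauliY, pauliZ, sub_eq_add_neg]
  sq_obsA a := by
    cases a <;> simp only [refObsA, Matrix.smul_mul, Matrix.mul_smul, smul_smul,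
      inv_sqrt_two_mul_self] <;>
      ext i j <;> fin_cases i <;> fin_cases j <;>
      simp [pauliX, pauliY, pauliZ] <;> ring_nf <;> simp <;> norm_num
  sq_obsB b := by
    cases b <;> simp only [refObsB, Matrix.smul_mul, Matrix.mul_smul, smul_smul,
      inv_sqrt_two_mul_self] <;>
      ext i j <;> fin_cases i <;> fin_cases j <;>
      simp [pauliX, pauliY, pauliZ] <;> ring_nf <;> simp <;> norm_num

/-- The physical experiment reproduces the outcome statistics of each of the three Mayers–Yao tests:
for all settings `a`, `b` that occur in a common test, the joint outcome distribution is that of the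
reference experiment. -/
def ReproducesExtMayersYao {HA HB : Type*}
    [NormedAddCommGroup HA] [InnerProductSpace ℂ HA] [CompleteSpace HA]
    [NormedAddCommGroup HB] [InnerProductSpace ℂ HB] [CompleteSpace HB]
    (P : Experiment Setting HA HB) : Prop :=
  ∀ t, ∀ a ∈ testSettings t, ∀ b ∈ testSettings t, ∀ x y,
    P.prob a b x y = extMayersYao.prob a b x y

end SelfTest

end

/-!
Write `M_A = M ⊗ 1` and `M_B = 1 ⊗ M` for the operators of the two parties on the bipartite space and
`ψ` for the physical state.

*Relations on the state.* For unit vectors, a correlation of `1` forces equality, so `M_A ψ = M_B ψ` for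
each of the six settings (`opA_state_eq_opB_state`). The remaining correlations say that `X ψ` and
`Z ψ` are orthogonal and that `D ψ` makes an angle `π / 4` with both, whence
`D ψ = (X ψ + Z ψ) / √2` (`opA_diagonal`). Expanding `ψ = D_A D_B ψ = (X_A + Z_A)² ψ / 2` gives
`(X Z + Z X) ψ = 0` (`opA_anticomm`); the settings `E` and `F` treat the pairs `X, Y` and `Y, Z` alike.

*From the state to a subspace.* Any operator of Bob commutes with Alice's relations, so they hold on
the whole orbit of `ψ` under operators commuting with `X_A, Y_A, Z_A`. This orbit is invariant under
`X_A, Y_A, Z_A`, because their action on `ψ` is that of an operator of Bob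
(`PauliOn.exists_restrict`). There, exact computation with anticommuting involutions is possible.

*The isometry.* The relations fix `X, Y, Z` up to the operator `W = i Y X Z`, which is an involution
commuting with `X` and `Z` on that subspace; its two eigenspaces carry the Pauli matrices and their
conjugates. Each party swaps the qubit of `X` and `Z` into a register `Q` and writes the eigenvalue of
`W` into a register `P`. The coefficients of this map are `swapCoeff`, and the map is an isometry on
the whole space because `X`, `Y`, `Z` are unitary (`swapIsometry`). The relations turn `X, Y, Z`
into `C(X), C(Y), C(Z)` (`simulates_opA`, `simulates_opB`). On the state, Bob's coefficients become
reversed words in Alice's operators, and `PauliRelations.swapCoeff_mul_swapCoeffRev` shows that only the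
diagonal components survive and that they do not depend on `Q` (`coeff_state`). This is the
simulation state, whose two branches are the components of `ψ` in the two eigenspaces of `W`.
-/

noncomputable section

namespace SelfTest

/-! ### Local operators on the completed tensor product -/

section LocalOp

variable {E F E' F' E'' F'' : Type*}
  [NormedAddCommGroup E] [InnerProductSpace ℂ E] [NormedAddCommGroup F] [InnerProductSpace ℂ F]
  [NormedAddCommGroup E'] [InnerProductSpace ℂ E'] [NormedAddCommGroup F'] [InnerProductSpace ℂ F']
  [NormedAddCommGroup E''] [InnerProductSpace ℂ E'']
  [NormedAddCommGroup F''] [InnerProductSpace ℂ F'']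

theorem localOp_coe (f : E →L[ℂ] E') (g : F →L[ℂ] F') (t : E ⊗[ℂ] F) :
    localOp f g (t : Bipartite E F) = ((TensorProduct.mapL f g t : E' ⊗[ℂ] F') : Bipartite E' F') :=
  UniformSpace.Completion.map_coe (TensorProduct.mapL f g).uniformContinuous t

/-- Continuous linear maps out of the completed tensor product agree if they agree on the
algebraic tensor product. -/
theorem Bipartite.clm_ext {G : Type*} [NormedAddCommGroup G] [NormedSpace ℂ G]
    {f g : Bipartite E F →L[ℂ] G}
    (h : ∀ t : E ⊗[ℂ] F, f (t : Bipartite E F) = g (t : Bipartite E F)) : f = g := by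
  ext v
  induction v using UniformSpace.Completion.induction_on with
  | hp => exact isClosed_eq f.continuous g.continuous
  | ih t => exact h t

theorem localOp_add_left (f₁ f₂ : E →L[ℂ] E') (g : F →L[ℂ] F') :
    localOp (f₁ + f₂) g = localOp f₁ g + localOp f₂ g :=
  Bipartite.clm_ext fun t => by
    simp [localOp_coe, TensorProduct.mapL_add_left, UniformSpace.Completion.coe_add]

theorem localOp_add_right (f : E →L[ℂ] E') (g₁ g₂ : F →L[ℂ] F') :
    localOp f (g₁ + g₂) = localOp f g₁ + localOp f g₂ :=
  Bipartite.clm_ext fun t => by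
    simp [localOp_coe, TensorProduct.mapL_add_right, UniformSpace.Completion.coe_add]

theorem localOp_smul_left (c : ℂ) (f : E →L[ℂ] E') (g : F →L[ℂ] F') :
    localOp (c • f) g = c • localOp f g :=
  Bipartite.clm_ext fun t => by simp [localOp_coe, TensorProduct.mapL_smul_left]

theorem localOp_smul_right (c : ℂ) (f : E →L[ℂ] E') (g : F →L[ℂ] F') :
    localOp f (c • g) = c • localOp f g :=
  Bipartite.clm_ext fun t => by simp [localOp_coe, TensorProduct.mapL_smul_right]

theorem localOp_comp (f₁ : E' →L[ℂ] E'') (f₂ : E →L[ℂ] E') (g₁ : F' →L[ℂ] F'')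
    (g₂ : F →L[ℂ] F') :
    localOp (f₁ ∘L f₂) (g₁ ∘L g₂) = localOp f₁ g₁ ∘L localOp f₂ g₂ :=
  Bipartite.clm_ext fun t => by
    simp only [ContinuousLinearMap.comp_apply, localOp_coe, TensorProduct.mapL_comp]

theorem localOp_mul (f₁ f₂ : E →L[ℂ] E) (g₁ g₂ : F →L[ℂ] F) :
    localOp (f₁ * f₂) (g₁ * g₂) = localOp f₁ g₁ * localOp f₂ g₂ :=
  localOp_comp f₁ f₂ g₁ g₂

theorem localOp_one : localOp (1 : E →L[ℂ] E) (1 : F →L[ℂ] F) = 1 :=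
  Bipartite.clm_ext fun t => by
    rw [localOp_coe, ContinuousLinearMap.one_def, ContinuousLinearMap.one_def,
      TensorProduct.mapL_id_id]
    rfl

/-- `localOp` as a bilinear map. -/
def localOpBilin (E F E' F' : Type*)
    [NormedAddCommGroup E] [InnerProductSpace ℂ E] [NormedAddCommGroup F] [InnerProductSpace ℂ F]
    [NormedAddCommGroup E'] [InnerProductSpace ℂ E']
    [NormedAddCommGroup F'] [InnerProductSpace ℂ F'] :
    (E →L[ℂ] E') →ₗ[ℂ] (F →L[ℂ] F') →ₗ[ℂ] (Bipartite E F →L[ℂ] Bipartite E' F') :=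
  LinearMap.mk₂ ℂ localOp localOp_add_left localOp_smul_left localOp_add_right localOp_smul_right

theorem localOp_sum_sum {ι κ : Type*} (s : Finset ι) (t : Finset κ) (f : ι → E →L[ℂ] E')
    (g : κ → F →L[ℂ] F') :
    localOp (∑ i ∈ s, f i) (∑ j ∈ t, g j) = ∑ i ∈ s, ∑ j ∈ t, localOp (f i) (g j) := by
  change localOpBilin E F E' F' _ _ = ∑ i ∈ s, ∑ j ∈ t, localOpBilin E F E' F' (f i) (g j)
  simp only [map_sum, LinearMap.sum_apply]
  exact Finset.sum_comm

/-- Operators on the first factor, acting on the bipartite space. -/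
def leftOp (E F : Type*) [NormedAddCommGroup E] [InnerProductSpace ℂ E]
    [NormedAddCommGroup F] [InnerProductSpace ℂ F] :
    (E →L[ℂ] E) →ₐ[ℂ] (Bipartite E F →L[ℂ] Bipartite E F) :=
  AlgHom.ofLinearMap ((localOpBilin E F E F).flip 1) localOp_one fun f₁ f₂ => by
    change localOp (f₁ * f₂) 1 = localOp f₁ 1 * localOp f₂ 1
    rw [← localOp_mul, one_mul]

/-- Operators on the second factor, acting on the bipartite space. -/
def rightOp (E F : Type*) [NormedAddCommGroup E] [InnerProductSpace ℂ E]
    [NormedAddCommGroup F] [InnerProductSpace ℂ F] :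
    (F →L[ℂ] F) →ₐ[ℂ] (Bipartite E F →L[ℂ] Bipartite E F) :=
  AlgHom.ofLinearMap (localOpBilin E F E F 1) localOp_one fun f₁ f₂ => by
    change localOp 1 (f₁ * f₂) = localOp 1 f₁ * localOp 1 f₂
    rw [← localOp_mul, one_mul]

theorem leftOp_apply (f : E →L[ℂ] E) : leftOp E F f = localOp f 1 := rfl

theorem rightOp_apply (g : F →L[ℂ] F) : rightOp E F g = localOp 1 g := rfl

theorem localOp_eq_leftOp_mul_rightOp (f : E →L[ℂ] E) (g : F →L[ℂ] F) :
    localOp f g = leftOp E F f * rightOp E F g := by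
  rw [leftOp_apply, rightOp_apply, ← localOp_mul, mul_one, one_mul]

theorem leftOp_commute_rightOp (f : E →L[ℂ] E) (g : F →L[ℂ] F) :
    Commute (leftOp E F f) (rightOp E F g) := by
  rw [Commute, SemiconjBy, leftOp_apply, rightOp_apply, ← localOp_mul, ← localOp_mul, mul_one,
    one_mul, mul_one, one_mul]

theorem inner_localOp_left [CompleteSpace E] [CompleteSpace F] {f : E →L[ℂ] E} {g : F →L[ℂ] F}
    (hf : IsSelfAdjoint f) (hg : IsSelfAdjoint g) (u v : Bipartite E F) :
    inner ℂ (localOp f g u) v = inner ℂ u (localOp f g v) := by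
  have hf' (x y : E) : inner ℂ (f x) y = inner ℂ x (f y) := hf.isSymmetric x y
  have hg' (x y : F) : inner ℂ (g x) y = inner ℂ x (g y) := hg.isSymmetric x y
  induction u, v using UniformSpace.Completion.induction_on₂ with
  | hp =>
    exact isClosed_eq (((localOp f g).continuous.comp continuous_fst).inner continuous_snd)
      (continuous_fst.inner ((localOp f g).continuous.comp continuous_snd))
  | ih s t =>
    simp only [localOp_coe, UniformSpace.Completion.inner_coe]
    induction s using TensorProduct.induction_on with
    | zero => simp
    | add s₁ s₂ h₁ h₂ => simp only [map_add, inner_add_left, h₁, h₂]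
    | tmul a b =>
      induction t using TensorProduct.induction_on with
      | zero => simp
      | add t₁ t₂ h₁ h₂ => simp only [map_add, inner_add_right, h₁, h₂]
      | tmul c d => simp only [TensorProduct.mapL_tmul, TensorProduct.inner_tmul, hf', hg']

theorem leftOp_isSymmetric [CompleteSpace E] [CompleteSpace F] {f : E →L[ℂ] E}
    (hf : IsSelfAdjoint f) (u v : Bipartite E F) :
    inner ℂ (leftOp E F f u) v = inner ℂ u (leftOp E F f v) :=
  inner_localOp_left hf (IsSelfAdjoint.one _) u v

theorem rightOp_isSymmetric [CompleteSpace E] [CompleteSpace F] {g : F →L[ℂ] F}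
    (hg : IsSelfAdjoint g) (u v : Bipartite E F) :
    inner ℂ (rightOp E F g u) v = inner ℂ u (rightOp E F g v) :=
  inner_localOp_left (IsSelfAdjoint.one _) hg u v

end LocalOp

/-! ### Pauli relations and the coefficients of the local isometry -/

/-- Three pairwise anticommuting involutions of a ring. The product `x * y * z` is left free, so a
direct sum of the Pauli representation and its complex conjugate is allowed. -/
structure PauliRelations {A : Type*} [Ring A] (x y z : A) : Prop where
  x_sq : x * x = 1
  y_sq : y * y = 1
  z_sq : z * z = 1
  y_mul_x : y * x = -(x * y)
  z_mul_x : z * x = -(x * z)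
  z_mul_y : z * y = -(y * z)

namespace PauliRelations

variable {A : Type*} [Ring A] {x y z : A}

theorem x_mul_x_mul (h : PauliRelations x y z) (w : A) : x * (x * w) = w := by
  rw [← mul_assoc, h.x_sq, one_mul]

theorem y_mul_y_mul (h : PauliRelations x y z) (w : A) : y * (y * w) = w := by
  rw [← mul_assoc, h.y_sq, one_mul]

theorem y_mul_x_mul (h : PauliRelations x y z) (w : A) : y * (x * w) = -(x * (y * w)) := by
  rw [← mul_assoc, h.y_mul_x, neg_mul, mul_assoc]

theorem z_mul_x_mul (h : PauliRelations x y z) (w : A) : z * (x * w) = -(x * (z * w)) := by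
  rw [← mul_assoc, h.z_mul_x, neg_mul, mul_assoc]

theorem z_mul_y_mul (h : PauliRelations x y z) (w : A) : z * (y * w) = -(y * (z * w)) := by
  rw [← mul_assoc, h.z_mul_y, neg_mul, mul_assoc]

end PauliRelations

/-- The outcome `(-1) ^ p` that belongs to the computational basis state `p` of a qubit. -/
def outcomeSign (p : Fin 2) : ℤˣ := (-1) ^ (p : ℕ)

section Coeff

variable {A : Type*} [Ring A] [Algebra ℂ A]

/-- The coefficient at the basis state `|p⟩|q⟩` of the extra qubits in the local isometry built from
`x`, `y`, `z`. The factor `x ^ q * (1 + (-1) ^ q z) / 2` swaps the qubit on which `x` and `z` act into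
the register `Q`; the factor `(1 + (-1) ^ p W) / 2`, with `W = i y x z`, records in the register `P`
whether `y` acts as the Pauli matrix `Y` or as its conjugate. -/
def swapCoeff (x y z : A) (i : Fin 2 × Fin 2) : A :=
  outcomeProj (Complex.I • (y * x * z)) (outcomeSign i.1) *
    (x ^ (i.2 : ℕ) * outcomeProj z (outcomeSign i.2))

/-- The coefficient `swapCoeff` with the order of multiplication reversed and the sign of `y`
flipped: what Bob's coefficient becomes when its action on the state is moved to Alice. -/
def swapCoeffRev (x y z : A) (i : Fin 2 × Fin 2) : A :=
  outcomeProj z (outcomeSign i.2) * x ^ (i.2 : ℕ) *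
    outcomeProj (Complex.I • (z * (x * -y))) (outcomeSign i.1)

theorem map_swapCoeff {B : Type*} [Ring B] [Algebra ℂ B] (φ : A →ₐ[ℂ] B) (x y z : A)
    (i : Fin 2 × Fin 2) : φ (swapCoeff x y z i) = swapCoeff (φ x) (φ y) (φ z) i := by
  simp only [swapCoeff, outcomeProj, map_mul, map_smul, map_add, map_one, map_pow]

theorem map_swapCoeffRev {B : Type*} [Ring B] [Algebra ℂ B] (φ : A →ₐ[ℂ] B) (x y z : A)
    (i : Fin 2 × Fin 2) : φ (swapCoeffRev x y z i) = swapCoeffRev (φ x) (φ y) (φ z) i := by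
  simp only [swapCoeffRev, outcomeProj, map_mul, map_smul, map_add, map_one, map_pow, map_neg]

namespace PauliRelations

variable {x y z : A}

theorem swapCoeff_mul_x (h : PauliRelations x y z) (i : Fin 2 × Fin 2) :
    swapCoeff x y z i * x = ∑ j, simOp pauliX i j • swapCoeff x y z j := by
  obtain ⟨p, q⟩ := i
  fin_cases p <;> fin_cases q <;>
    simp [Fintype.sum_prod_type, simOp, pauliX, swapCoeff, outcomeProj, outcomeSign,
      mul_add, add_mul, mul_assoc, h.x_sq, h.z_sq, h.y_mul_x, h.z_mul_x,
      h.x_mul_x_mul, h.y_mul_x_mul, h.z_mul_x_mul] <;>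
    module

theorem swapCoeff_mul_z (h : PauliRelations x y z) (i : Fin 2 × Fin 2) :
    swapCoeff x y z i * z = ∑ j, simOp pauliZ i j • swapCoeff x y z j := by
  obtain ⟨p, q⟩ := i
  fin_cases p <;> fin_cases q <;>
    simp [Fintype.sum_prod_type, simOp, pauliZ, swapCoeff, outcomeProj, outcomeSign,
      mul_add, add_mul, mul_assoc, h.z_sq, h.y_mul_x, h.z_mul_x,
      h.x_mul_x_mul, h.y_mul_x_mul, h.z_mul_x_mul] <;>
    module

theorem swapCoeff_mul_y (h : PauliRelations x y z) (i : Fin 2 × Fin 2) :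
    swapCoeff x y z i * y = ∑ j, simOp pauliY i j • swapCoeff x y z j := by
  obtain ⟨p, q⟩ := i
  fin_cases p <;> fin_cases q <;>
    simp [Fintype.sum_prod_type, simOp, pauliY, swapCoeff, outcomeProj, outcomeSign,
      mul_add, add_mul, mul_assoc, h.y_sq, h.z_sq, h.y_mul_x, h.z_mul_x, h.z_mul_y,
      h.x_mul_x_mul, h.y_mul_y_mul, h.y_mul_x_mul, h.z_mul_x_mul,
      smul_smul] <;>
    match_scalars <;> ring_nf <;> norm_num [Complex.I_sq]

theorem swapCoeff_mul_swapCoeffRev (h : PauliRelations x y z) (i j : Fin 2 × Fin 2) :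
    swapCoeff x y z i * swapCoeffRev x y z j = if i = j then swapCoeff x y z (i.1, 0) else 0 := by
  obtain ⟨p, q⟩ := i
  obtain ⟨p', q'⟩ := j
  fin_cases p <;> fin_cases q <;> fin_cases p' <;> fin_cases q' <;>
    simp [swapCoeff, swapCoeffRev, outcomeProj, outcomeSign,
      mul_add, add_mul, mul_assoc, h.x_sq, h.y_sq, h.z_sq, h.y_mul_x, h.z_mul_x, h.z_mul_y,
      h.x_mul_x_mul, h.y_mul_y_mul, h.y_mul_x_mul, h.z_mul_x_mul, h.z_mul_y_mul,
      smul_smul] <;>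
    match_scalars <;> ring_nf <;> norm_num [Complex.I_sq]

end PauliRelations

end Coeff

/-! ### Operators that satisfy the Pauli relations on a state -/

section PauliOn

variable {V : Type*} [NormedAddCommGroup V] [NormedSpace ℂ V]

/-- Three involutions that anticommute on the single vector `ψ`, and whose action on `ψ` can be
replaced by that of operators commuting with all three (operators of the other party). -/
structure PauliOn (ψ : V) (x y z : V →L[ℂ] V) : Prop where
  x_sq : x * x = 1
  y_sq : y * y = 1
  z_sq : z * z = 1
  y_mul_x : (y * x) ψ = -(x * y) ψ
  z_mul_x : (z * x) ψ = -(x * z) ψ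
  z_mul_y : (z * y) ψ = -(y * z) ψ
  mirror_x : ∃ t ∈ Subalgebra.centralizer ℂ {x, y, z}, x ψ = t ψ
  mirror_y : ∃ t ∈ Subalgebra.centralizer ℂ {x, y, z}, y ψ = t ψ
  mirror_z : ∃ t ∈ Subalgebra.centralizer ℂ {x, y, z}, z ψ = t ψ

theorem swapCoeff_restrict_apply {x y z : V →L[ℂ] V} {D : Submodule ℂ V}
    (hx : ∀ v ∈ D, (x : V →ₗ[ℂ] V) v ∈ D) (hy : ∀ v ∈ D, (y : V →ₗ[ℂ] V) v ∈ D)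
    (hz : ∀ v ∈ D, (z : V →ₗ[ℂ] V) v ∈ D) (i : Fin 2 × Fin 2) (w : D) :
    ((swapCoeff (A := Module.End ℂ D) ((x : V →ₗ[ℂ] V).restrict hx) ((y : V →ₗ[ℂ] V).restrict hy)
      ((z : V →ₗ[ℂ] V).restrict hz) i w : D) : V) = swapCoeff x y z i w := by
  obtain ⟨p, q⟩ := i
  fin_cases q <;> simp [swapCoeff, outcomeProj]

theorem swapCoeffRev_restrict_apply {x y z : V →L[ℂ] V} {D : Submodule ℂ V}
    (hx : ∀ v ∈ D, (x : V →ₗ[ℂ] V) v ∈ D) (hy : ∀ v ∈ D, (y : V →ₗ[ℂ] V) v ∈ D)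
    (hz : ∀ v ∈ D, (z : V →ₗ[ℂ] V) v ∈ D) (i : Fin 2 × Fin 2) (w : D) :
    ((swapCoeffRev (A := Module.End ℂ D) ((x : V →ₗ[ℂ] V).restrict hx)
      ((y : V →ₗ[ℂ] V).restrict hy) ((z : V →ₗ[ℂ] V).restrict hz) i w : D) : V)
      = swapCoeffRev x y z i w := by
  obtain ⟨p, q⟩ := i
  fin_cases q <;> simp [swapCoeffRev, outcomeProj]

namespace PauliOn

variable {ψ : V} {x y z : V →L[ℂ] V}

/-- The relations extend from `ψ` to an invariant subspace: the orbit of `ψ` under the commutant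
of the three operators. -/
theorem exists_restrict (h : PauliOn ψ x y z) :
    ∃ (D : Submodule ℂ V) (hx : ∀ v ∈ D, (x : V →ₗ[ℂ] V) v ∈ D)
      (hy : ∀ v ∈ D, (y : V →ₗ[ℂ] V) v ∈ D) (hz : ∀ v ∈ D, (z : V →ₗ[ℂ] V) v ∈ D),
      ψ ∈ D ∧ PauliRelations (A := Module.End ℂ D) ((x : V →ₗ[ℂ] V).restrict hx)
        ((y : V →ₗ[ℂ] V).restrict hy) ((z : V →ₗ[ℂ] V).restrict hz) := by
  let T := Subalgebra.centralizer ℂ {x, y, z}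
  let D : Submodule ℂ V := T.toSubmodule.map
    (ContinuousLinearMap.apply ℂ V ψ : (V →L[ℂ] V) →ₗ[ℂ] V)
  have mem (v : V) : v ∈ D ↔ ∃ t ∈ T, t ψ = v := Iff.rfl
  have comm {t a : V →L[ℂ] V} (ht : t ∈ T) (ha : a ∈ ({x, y, z} : Set (V →L[ℂ] V))) (v : V) :
      a (t v) = t (a v) := by
    have := (Subalgebra.mem_centralizer_iff ℂ).1 ht a ha
    exact DFunLike.congr_fun this v
  have mx : x ∈ ({x, y, z} : Set (V →L[ℂ] V)) := by simp
  have my : y ∈ ({x, y, z} : Set (V →L[ℂ] V)) := by simp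
  have mz : z ∈ ({x, y, z} : Set (V →L[ℂ] V)) := by simp
  have inv {a : V →L[ℂ] V} (ha : a ∈ ({x, y, z} : Set (V →L[ℂ] V))) (hm : ∃ t ∈ T, a ψ = t ψ) :
      ∀ v ∈ D, (a : V →ₗ[ℂ] V) v ∈ D := by
    rintro v hv
    obtain ⟨t, ht, rfl⟩ := (mem v).1 hv
    obtain ⟨s, hs, has⟩ := hm
    exact (mem _).2 ⟨t * s, T.mul_mem ht hs, by
      rw [mul_apply_eq_comp, ← has]; exact (comm ht ha ψ).symm⟩
  have sq {a : V →L[ℂ] V} (ha : ∀ v ∈ D, (a : V →ₗ[ℂ] V) v ∈ D) (h1 : a * a = 1) :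
      ((a : V →ₗ[ℂ] V).restrict ha : Module.End ℂ D) * (a : V →ₗ[ℂ] V).restrict ha = 1 := by
    ext v
    exact DFunLike.congr_fun h1 (v : V)
  have anti {a b : V →L[ℂ] V} (ha : a ∈ ({x, y, z} : Set (V →L[ℂ] V)))
      (hb : b ∈ ({x, y, z} : Set (V →L[ℂ] V)))
      (ha' : ∀ v ∈ D, (a : V →ₗ[ℂ] V) v ∈ D) (hb' : ∀ v ∈ D, (b : V →ₗ[ℂ] V) v ∈ D)
      (hab : (a * b) ψ = -(b * a) ψ) :
      ((a : V →ₗ[ℂ] V).restrict ha' : Module.End ℂ D) * (b : V →ₗ[ℂ] V).restrict hb'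
        = -((b : V →ₗ[ℂ] V).restrict hb' * (a : V →ₗ[ℂ] V).restrict ha') := by
    ext ⟨v, hv⟩
    obtain ⟨t, ht, rfl⟩ := (mem v).1 hv
    change a (b (t ψ)) = -b (a (t ψ))
    rw [comm ht hb, comm ht ha, comm ht ha, comm ht hb, ← map_neg]
    exact congrArg t hab
  exact ⟨D, inv mx h.mirror_x, inv my h.mirror_y, inv mz h.mirror_z,
    (mem ψ).2 ⟨1, T.one_mem, rfl⟩,
    ⟨sq _ h.x_sq, sq _ h.y_sq, sq _ h.z_sq, anti my mx _ _ h.y_mul_x, anti mz mx _ _ h.z_mul_x,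
      anti mz my _ _ h.z_mul_y⟩⟩

theorem swapCoeff_x (h : PauliOn ψ x y z) (i : Fin 2 × Fin 2) :
    swapCoeff x y z i (x ψ) = ∑ j, simOp pauliX i j • swapCoeff x y z j ψ := by
  obtain ⟨D, hx, hy, hz, hψ, hD⟩ := h.exists_restrict
  have := congrArg (fun T : Module.End ℂ D => (T ⟨ψ, hψ⟩ : V)) (hD.swapCoeff_mul_x i)
  simpa [swapCoeff_restrict_apply] using this

theorem swapCoeff_y (h : PauliOn ψ x y z) (i : Fin 2 × Fin 2) :
    swapCoeff x y z i (y ψ) = ∑ j, simOp pauliY i j • swapCoeff x y z j ψ := by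
  obtain ⟨D, hx, hy, hz, hψ, hD⟩ := h.exists_restrict
  have := congrArg (fun T : Module.End ℂ D => (T ⟨ψ, hψ⟩ : V)) (hD.swapCoeff_mul_y i)
  simpa [swapCoeff_restrict_apply] using this

theorem swapCoeff_z (h : PauliOn ψ x y z) (i : Fin 2 × Fin 2) :
    swapCoeff x y z i (z ψ) = ∑ j, simOp pauliZ i j • swapCoeff x y z j ψ := by
  obtain ⟨D, hx, hy, hz, hψ, hD⟩ := h.exists_restrict
  have := congrArg (fun T : Module.End ℂ D => (T ⟨ψ, hψ⟩ : V)) (hD.swapCoeff_mul_z i)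
  simpa [swapCoeff_restrict_apply] using this

theorem swapCoeff_swapCoeffRev (h : PauliOn ψ x y z) (i j : Fin 2 × Fin 2) :
    swapCoeff x y z i (swapCoeffRev x y z j ψ)
      = if i = j then swapCoeff x y z (i.1, 0) ψ else 0 := by
  obtain ⟨D, hx, hy, hz, hψ, hD⟩ := h.exists_restrict
  have := congrArg (fun T : Module.End ℂ D => (T ⟨ψ, hψ⟩ : V)) (hD.swapCoeff_mul_swapCoeffRev i j)
  simp only [Module.End.mul_apply, swapCoeff_restrict_apply, swapCoeffRev_restrict_apply] at this
  rw [this]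
  split_ifs <;> simp [swapCoeff_restrict_apply]

end PauliOn

end PauliOn

/-! ### Correlations -/

theorem outcomeProj_one_sub_neg_one {A : Type*} [Ring A] [Algebra ℂ A] (M : A) :
    outcomeProj M 1 - outcomeProj M (-1) = M := by
  simp only [outcomeProj, Units.val_one, Units.val_neg, Int.cast_one, Int.cast_neg]
  module

/-- The correlation of two `±1`-valued observables, from the joint distribution of the outcomes. -/
theorem Experiment.re_inner_eq_sum_prob {S HA HB : Type*}
    [NormedAddCommGroup HA] [InnerProductSpace ℂ HA] [CompleteSpace HA]
    [NormedAddCommGroup HB] [InnerProductSpace ℂ HB] [CompleteSpace HB]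
    (P : Experiment S HA HB) (a b : S) :
    (inner ℂ P.state (localOp (P.obsA a) (P.obsB b) P.state)).re
      = P.prob a b 1 1 - P.prob a b 1 (-1) - P.prob a b (-1) 1 + P.prob a b (-1) (-1) := by
  conv_lhs =>
    rw [← outcomeProj_one_sub_neg_one (P.obsA a), ← outcomeProj_one_sub_neg_one (P.obsB b)]
  change (inner ℂ P.state (localOpBilin HA HB HA HB _ _ P.state)).re = _
  simp only [map_sub, LinearMap.sub_apply, sub_apply, inner_sub_right,
    Complex.sub_re]
  change _ = (inner ℂ P.state (localOpBilin HA HB HA HB _ _ P.state)).re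
    - (inner ℂ P.state (localOpBilin HA HB HA HB _ _ P.state)).re
    - (inner ℂ P.state (localOpBilin HA HB HA HB _ _ P.state)).re
    + (inner ℂ P.state (localOpBilin HA HB HA HB _ _ P.state)).re
  ring

theorem RefExperiment.re_dotProduct_eq_sum_prob {S m n : Type*} [Fintype m] [DecidableEq m]
    [Fintype n] [DecidableEq n] (R : RefExperiment S m n) (a b : S) :
    (star R.state ⬝ᵥ (R.obsA a ⊗ₖ R.obsB b).mulVec R.state).re
      = R.prob a b 1 1 - R.prob a b 1 (-1) - R.prob a b (-1) 1 + R.prob a b (-1) (-1) := by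
  have hA (M₁ M₂ : Matrix m m ℂ) (N : Matrix n n ℂ) : (M₁ - M₂) ⊗ₖ N = M₁ ⊗ₖ N - M₂ ⊗ₖ N := by
    ext; simp [sub_mul]
  have hB (M : Matrix m m ℂ) (N₁ N₂ : Matrix n n ℂ) : M ⊗ₖ (N₁ - N₂) = M ⊗ₖ N₁ - M ⊗ₖ N₂ := by
    ext; simp [mul_sub]
  conv_lhs =>
    rw [← outcomeProj_one_sub_neg_one (R.obsA a), ← outcomeProj_one_sub_neg_one (R.obsB b)]
  simp only [RefExperiment.prob, hA, hB, Matrix.sub_mulVec,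
    dotProduct_sub, Complex.sub_re]
  ring

theorem dotProduct_phiPlus (M N : Matrix (Fin 2) (Fin 2) ℂ) :
    star phiPlus ⬝ᵥ (M ⊗ₖ N).mulVec phiPlus = 1 / 2 * ∑ i, ∑ j, M i j * N i j := by
  simp only [dotProduct, Matrix.mulVec, Fintype.sum_prod_type, Pi.star_apply, phiPlus,
    Fin.sum_univ_two, Matrix.kroneckerMap_apply, RCLike.star_def, apply_ite (starRingEnd ℂ),
    Complex.conj_ofReal, ← inv_sqrt_two_mul_self]
  simp
  ring

/-- The reference correlation of Alice's setting `a` and Bob's setting `b`. -/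
def refCorr (a b : Setting) : ℝ :=
  ((1 / 2 : ℂ) * ∑ i, ∑ j, refObsA a i j * refObsB b i j).re

theorem refCorr_self (a : Setting) : refCorr a a = 1 := by
  have h2 : √2 * √2 = 2 := by norm_num
  cases a <;> simp [refCorr, refObsA, refObsB, pauliX, pauliY, pauliZ, Fin.sum_univ_two] <;>
    field_simp <;> norm_num

section Vectors

variable {V : Type*} [NormedAddCommGroup V] [InnerProductSpace ℂ V]

theorem eq_of_norm_one_of_re_inner_eq_one {u v : V} (hu : ‖u‖ = 1) (hv : ‖v‖ = 1)
    (h : (inner ℂ u v).re = 1) : u = v := by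
  have := @norm_sub_sq ℂ V _ _ _ u v
  rw [hu, hv, RCLike.re_eq_complex_re, h] at this
  rw [← sub_eq_zero, ← norm_eq_zero]
  nlinarith

/-- A unit vector at angle `π / 4` to each of two (real-)orthogonal unit vectors is their normalised
sum. -/
theorem eq_smul_add_of_re_inner {u v w : V} (hu : ‖u‖ = 1) (hv : ‖v‖ = 1) (hw : ‖w‖ = 1)
    (huv : (inner ℂ u v).re = 0) (huw : (inner ℂ u w).re = 1 / √2)
    (hvw : (inner ℂ v w).re = 1 / √2) : w = ((1 / √2 : ℝ) : ℂ) • (u + v) := by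
  have h2 : (1 / √2) * (1 / √2) = (1 / 2 : ℝ) := by
    rw [div_mul_div_comm, Real.mul_self_sqrt (by norm_num), one_mul]
  have hpos : (0 : ℝ) < 1 / √2 := by positivity
  refine (eq_of_norm_one_of_re_inner_eq_one ?_ hw ?_).symm
  · have := @norm_add_sq ℂ V _ _ _ u v
    rw [hu, hv, RCLike.re_eq_complex_re, huv] at this
    rw [norm_smul, Complex.norm_real, Real.norm_of_nonneg hpos.le]
    have h3 : (1 / √2 * ‖u + v‖) ^ 2 = 1 := by
      rw [mul_pow, this, pow_two, h2]; norm_num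
    exact (pow_eq_one_iff_of_nonneg (by positivity) two_ne_zero).1 h3
  · rw [inner_smul_left, Complex.conj_ofReal, Complex.re_ofReal_mul, inner_add_left,
      Complex.add_re, huw, hvw]
    linarith

theorem norm_apply_of_symmetric_of_sq {T : V →L[ℂ] V}
    (hT : ∀ u v, inner ℂ (T u) v = inner ℂ u (T v)) (h : T * T = 1) (v : V) :
    ‖T v‖ = ‖v‖ := by
  have h' : T (T v) = v := DFunLike.congr_fun h v
  rw [@norm_eq_sqrt_re_inner ℂ, @norm_eq_sqrt_re_inner ℂ _ _ _ _ v, hT, h']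

end Vectors

/-! ### Mayers–Yao relations in the physical experiment -/

/-- The setting `d` measures the normalised sum of the orthogonal settings `s` and `t`, and all three
occur in a common test. -/
structure IsDiagonal (s t d : Setting) : Prop where
  exists_test : ∃ k, s ∈ testSettings k ∧ t ∈ testSettings k ∧ d ∈ testSettings k
  refCorr_orth : refCorr s t = 0
  refCorr_left : refCorr s d = 1 / √2
  refCorr_right : refCorr t d = 1 / √2

theorem isDiagonal_D : IsDiagonal .X .Z .D :=
  ⟨⟨0, by simp [testSettings]⟩,
    by simp [refCorr, refObsA, refObsB, pauliX, pauliZ, Fin.sum_univ_two],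
    by simp [refCorr, refObsA, refObsB, pauliX, pauliZ, Fin.sum_univ_two]; field_simp; norm_num,
    by simp [refCorr, refObsA, refObsB, pauliX, pauliZ, Fin.sum_univ_two]; field_simp; norm_num⟩

theorem isDiagonal_E : IsDiagonal .X .Y .E :=
  ⟨⟨1, by simp [testSettings]⟩,
    by simp [refCorr, refObsA, refObsB, pauliX, pauliY, Fin.sum_univ_two],
    by simp [refCorr, refObsA, refObsB, pauliX, pauliY, Fin.sum_univ_two]; field_simp; norm_num,
    by simp [refCorr, refObsA, refObsB, pauliX, pauliY, Fin.sum_univ_two]; field_simp; norm_num⟩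

theorem isDiagonal_F : IsDiagonal .Y .Z .F :=
  ⟨⟨2, by simp [testSettings]⟩,
    by simp [refCorr, refObsA, refObsB, pauliY, pauliZ, Fin.sum_univ_two],
    by simp [refCorr, refObsA, refObsB, pauliY, pauliZ, Fin.sum_univ_two]; field_simp; norm_num,
    by simp [refCorr, refObsA, refObsB, pauliY, pauliZ, Fin.sum_univ_two]; field_simp; norm_num⟩

section Physical

variable {S HA HB : Type*}
  [NormedAddCommGroup HA] [InnerProductSpace ℂ HA] [CompleteSpace HA]
  [NormedAddCommGroup HB] [InnerProductSpace ℂ HB] [CompleteSpace HB]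

namespace Experiment

/-- Alice's observable, acting on the bipartite space. -/
def opA (P : Experiment S HA HB) (s : S) : Bipartite HA HB →L[ℂ] Bipartite HA HB :=
  leftOp HA HB (P.obsA s)

/-- Bob's observable, acting on the bipartite space. -/
def opB (P : Experiment S HA HB) (s : S) : Bipartite HA HB →L[ℂ] Bipartite HA HB :=
  rightOp HA HB (P.obsB s)

theorem opA_mul_self (P : Experiment S HA HB) (s : S) : P.opA s * P.opA s = 1 := by
  rw [opA, ← map_mul, P.sq_obsA, map_one]

theorem opB_mul_self (P : Experiment S HA HB) (s : S) : P.opB s * P.opB s = 1 := by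
  rw [opB, ← map_mul, P.sq_obsB, map_one]

theorem opA_opB_comm (P : Experiment S HA HB) (s t : S) (v : Bipartite HA HB) :
    P.opA s (P.opB t v) = P.opB t (P.opA s v) :=
  DFunLike.congr_fun (leftOp_commute_rightOp (P.obsA s) (P.obsB t)) v

theorem norm_opA_apply (P : Experiment S HA HB) (s : S) (v : Bipartite HA HB) :
    ‖P.opA s v‖ = ‖v‖ :=
  norm_apply_of_symmetric_of_sq (leftOp_isSymmetric (P.selfAdjoint_obsA s)) (P.opA_mul_self s) v

theorem norm_opB_apply (P : Experiment S HA HB) (s : S) (v : Bipartite HA HB) :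
    ‖P.opB s v‖ = ‖v‖ :=
  norm_apply_of_symmetric_of_sq (rightOp_isSymmetric (P.selfAdjoint_obsB s)) (P.opB_mul_self s) v

end Experiment

variable {P : Experiment Setting HA HB}

namespace ReproducesExtMayersYao

theorem re_inner_opA_opB (hP : ReproducesExtMayersYao P) {k : Fin 3} {s t : Setting}
    (hs : s ∈ testSettings k) (ht : t ∈ testSettings k) :
    (inner ℂ (P.opA s P.state) (P.opB t P.state)).re = refCorr s t := by
  rw [Experiment.opA, leftOp_isSymmetric (P.selfAdjoint_obsA s), Experiment.opB,
    ← mul_apply_eq_comp, ← localOp_eq_leftOp_mul_rightOp, P.re_inner_eq_sum_prob,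
    hP k s hs t ht, hP k s hs t ht, hP k s hs t ht, hP k s hs t ht,
    ← extMayersYao.re_dotProduct_eq_sum_prob, refCorr, ← dotProduct_phiPlus]
  rfl

theorem opA_state_eq_opB_state (hP : ReproducesExtMayersYao P) (s : Setting) :
    P.opA s P.state = P.opB s P.state := by
  obtain ⟨k, hs⟩ : ∃ k, s ∈ testSettings k := by
    cases s
    exacts [⟨0, by simp [testSettings]⟩, ⟨1, by simp [testSettings]⟩, ⟨0, by simp [testSettings]⟩,
      ⟨0, by simp [testSettings]⟩, ⟨1, by simp [testSettings]⟩, ⟨2, by simp [testSettings]⟩]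
  refine eq_of_norm_one_of_re_inner_eq_one ?_ ?_ ?_
  · rw [P.norm_opA_apply, P.norm_state]
  · rw [P.norm_opB_apply, P.norm_state]
  · rw [hP.re_inner_opA_opB hs hs, refCorr_self]

theorem opA_diagonal (hP : ReproducesExtMayersYao P) {s t d : Setting} (h : IsDiagonal s t d) :
    P.opA d P.state = ((1 / √2 : ℝ) : ℂ) • (P.opA s P.state + P.opA t P.state) := by
  obtain ⟨k, hs, ht, hd⟩ := h.exists_test
  refine eq_smul_add_of_re_inner ?_ ?_ ?_ ?_ ?_ ?_
  · rw [P.norm_opA_apply, P.norm_state]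
  · rw [P.norm_opA_apply, P.norm_state]
  · rw [P.norm_opA_apply, P.norm_state]
  · rw [hP.opA_state_eq_opB_state t, hP.re_inner_opA_opB hs ht, h.refCorr_orth]
  · rw [hP.opA_state_eq_opB_state d, hP.re_inner_opA_opB hs hd, h.refCorr_left]
  · rw [hP.opA_state_eq_opB_state d, hP.re_inner_opA_opB ht hd, h.refCorr_right]

theorem opB_diagonal (hP : ReproducesExtMayersYao P) {s t d : Setting} (h : IsDiagonal s t d) :
    P.opB d P.state = ((1 / √2 : ℝ) : ℂ) • (P.opB s P.state + P.opB t P.state) := by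
  simp only [← hP.opA_state_eq_opB_state, hP.opA_diagonal h]

/-- Squaring the diagonal observable, one factor on each side, shows that the two observables of
which it is the sum anticommute on the state. -/
theorem opA_anticomm (hP : ReproducesExtMayersYao P) {s t d : Setting} (h : IsDiagonal s t d) :
    P.opA t (P.opA s P.state) = -P.opA s (P.opA t P.state) := by
  have sq (r : Setting) (v : Bipartite HA HB) : P.opA r (P.opA r v) = v :=
    DFunLike.congr_fun (P.opA_mul_self r) v
  have hd : P.opB d P.state = ((1 / √2 : ℝ) : ℂ) • (P.opA s P.state + P.opA t P.state) := by
    rw [← hP.opA_state_eq_opB_state, hP.opA_diagonal h]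
  -- `ψ = D_A D_B ψ`; both factors become `(s + t) / √2` on Alice's side.
  have key := sq d P.state
  rw [hP.opA_state_eq_opB_state d, P.opA_opB_comm, hP.opA_diagonal h, map_smul, map_add,
    ← P.opA_opB_comm, ← P.opA_opB_comm, hd, map_smul, map_smul, ← smul_add, smul_smul,
    inv_sqrt_two_mul_self, map_add, map_add, sq, sq] at key
  rw [eq_neg_iff_add_eq_zero]
  linear_combination (norm := module) (2 : ℂ) • key

theorem opB_anticomm (hP : ReproducesExtMayersYao P) {s t d : Setting} (h : IsDiagonal s t d) :
    P.opB t (P.opB s P.state) = -P.opB s (P.opB t P.state) := by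
  rw [← hP.opA_state_eq_opB_state s, ← hP.opA_state_eq_opB_state t, ← P.opA_opB_comm,
    ← P.opA_opB_comm, ← hP.opA_state_eq_opB_state s, ← hP.opA_state_eq_opB_state t,
    hP.opA_anticomm h, neg_neg]

/-- Alice's observables `X`, `Y`, `Z` satisfy the Pauli relations on the state. -/
theorem pauliOn_opA (hP : ReproducesExtMayersYao P) :
    PauliOn P.state (P.opA .X) (P.opA .Y) (P.opA .Z) := by
  have mirror (s : Setting) : ∃ t ∈ Subalgebra.centralizer ℂ {P.opA .X, P.opA .Y, P.opA .Z},
      P.opA s P.state = t P.state := by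
    refine ⟨P.opB s, (Subalgebra.mem_centralizer_iff ℂ).2 ?_, hP.opA_state_eq_opB_state s⟩
    rintro _ (rfl | rfl | rfl) <;> exact leftOp_commute_rightOp _ _
  exact ⟨P.opA_mul_self _, P.opA_mul_self _, P.opA_mul_self _, hP.opA_anticomm isDiagonal_E,
    hP.opA_anticomm isDiagonal_D, hP.opA_anticomm isDiagonal_F, mirror _, mirror _, mirror _⟩

/-- Bob's observables satisfy the Pauli relations on the state, with `-Y` in the place of `Y` to
account for the sign of his reference observable. -/
theorem pauliOn_opB (hP : ReproducesExtMayersYao P) :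
    PauliOn P.state (P.opB .X) (-P.opB .Y) (P.opB .Z) := by
  have mirror (s : Setting) : P.opA s ∈
      Subalgebra.centralizer ℂ {P.opB .X, -P.opB .Y, P.opB .Z} := by
    rw [Subalgebra.mem_centralizer_iff]
    rintro _ (rfl | rfl | rfl)
    · exact (leftOp_commute_rightOp _ _).symm
    · exact (leftOp_commute_rightOp _ _).symm.neg_left
    · exact (leftOp_commute_rightOp _ _).symm
  refine ⟨P.opB_mul_self _, ?_, P.opB_mul_self _, ?_, hP.opB_anticomm isDiagonal_D, ?_,
    ⟨_, mirror .X, (hP.opA_state_eq_opB_state .X).symm⟩,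
    ⟨_, neg_mem (mirror .Y), congrArg Neg.neg (hP.opA_state_eq_opB_state .Y).symm⟩,
    ⟨_, mirror .Z, (hP.opA_state_eq_opB_state .Z).symm⟩⟩
  · rw [neg_mul_neg, P.opB_mul_self]
  · rw [neg_mul, mul_neg]
    exact congrArg Neg.neg (hP.opB_anticomm isDiagonal_E)
  · rw [neg_mul, mul_neg]
    exact congrArg Neg.neg (hP.opB_anticomm isDiagonal_F)

end ReproducesExtMayersYao

end Physical

/-! ### The local isometry -/

section Isometry

variable {H : Type*} [NormedAddCommGroup H] [InnerProductSpace ℂ H]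

/-- The parallelogram law for the coefficients `(1 ± T) / 2` of a controlled isometry. -/
theorem norm_sq_outcomeProj_add {T : H →L[ℂ] H} (hT : ∀ v, ‖T v‖ = ‖v‖) (v : H) :
    ‖outcomeProj T 1 v‖ ^ 2 + ‖outcomeProj T (-1) v‖ ^ 2 = ‖v‖ ^ 2 := by
  have h := parallelogram_law_with_norm ℂ v (T v)
  have h1 : outcomeProj T 1 v = (1 / 2 : ℂ) • (v + T v) := by simp [outcomeProj]
  have h2 : outcomeProj T (-1) v = (1 / 2 : ℂ) • (v - T v) := by
    simp [outcomeProj, sub_eq_add_neg]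
  rw [h1, h2, norm_smul, norm_smul]
  rw [hT] at h
  norm_num
  linarith

theorem sum_norm_sq_swapCoeff {x y z : H →L[ℂ] H} (hx : ∀ v, ‖x v‖ = ‖v‖) (hy : ∀ v, ‖y v‖ = ‖v‖)
    (hz : ∀ v, ‖z v‖ = ‖v‖) (v : H) : ∑ i, ‖swapCoeff x y z i v‖ ^ 2 = ‖v‖ ^ 2 := by
  have hW (u : H) : ‖(Complex.I • (y * x * z)) u‖ = ‖u‖ := by simp [norm_smul, hx, hy, hz]
  rw [Fintype.sum_prod_type_right]
  simp only [Fin.sum_univ_two, swapCoeff, outcomeSign, mul_apply_eq_comp, Fin.val_zero,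
    Fin.val_one, pow_zero, pow_one, norm_sq_outcomeProj_add hW, one_apply_eq_self, hx,
    norm_sq_outcomeProj_add hz]

theorem norm_sq_sum_attach {k : Type*} [Fintype k] [DecidableEq k] (h : k → H) :
    ‖∑ i, attach H i (h i)‖ ^ 2 = ∑ i, ‖h i‖ ^ 2 := by
  have hin (i j : k) : inner ℂ (attach H i (h i)) (attach H j (h j))
      = if i = j then inner ℂ (h i) (h i) else 0 := by
    change inner ℂ (h i ⊗ₜ[ℂ] EuclideanSpace.single i (1 : ℂ))
      (h j ⊗ₜ[ℂ] EuclideanSpace.single j (1 : ℂ)) = _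
    rw [TensorProduct.inner_tmul]
    split_ifs with hij
    · subst hij; simp
    · simp [EuclideanSpace.inner_single_left, hij]
  rw [@norm_sq_eq_re_inner ℂ, sum_inner]
  simp only [inner_sum, hin, Finset.sum_ite_eq, Finset.mem_univ, if_true, map_sum,
    ← @norm_sq_eq_re_inner ℂ]

/-- The isometry `h ↦ ∑ i, swapCoeff x y z i h ⊗ |i⟩`. -/
def swapIsometry (x y z : H →L[ℂ] H) (hx : ∀ v, ‖x v‖ = ‖v‖) (hy : ∀ v, ‖y v‖ = ‖v‖)
    (hz : ∀ v, ‖z v‖ = ‖v‖) : H →ₗᵢ[ℂ] H ⊗[ℂ] EuclideanSpace ℂ (Fin 2 × Fin 2) where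
  toLinearMap := (∑ i, attach H i ∘L swapCoeff x y z i).toLinearMap
  norm_map' v := by
    rw [← pow_left_inj₀ (norm_nonneg _) (norm_nonneg _) two_ne_zero,
      ← sum_norm_sq_swapCoeff hx hy hz v, ← norm_sq_sum_attach]
    simp

theorem swapIsometry_toContinuousLinearMap {x y z : H →L[ℂ] H} (hx : ∀ v, ‖x v‖ = ‖v‖)
    (hy : ∀ v, ‖y v‖ = ‖v‖) (hz : ∀ v, ‖z v‖ = ‖v‖) :
    (swapIsometry x y z hx hy hz).toContinuousLinearMap
      = ∑ i, attach H i ∘L swapCoeff x y z i := rfl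

end Isometry

/-! ### Simulated observables on one side -/

section SimOp

theorem simOp_add {m : Type*} (M N : Matrix m m ℂ) : simOp (M + N) = simOp M + simOp N := by
  ext ⟨p, i⟩ ⟨q, j⟩
  simp [simOp, mul_add]
  ring

theorem simOp_neg {m : Type*} (M : Matrix m m ℂ) : simOp (-M) = -simOp M := by
  ext ⟨p, i⟩ ⟨q, j⟩
  simp [simOp]
  ring

theorem simOp_ofReal_smul {m : Type*} (r : ℝ) (M : Matrix m m ℂ) :
    simOp ((r : ℂ) • M) = (r : ℂ) • simOp M := by
  ext ⟨p, i⟩ ⟨q, j⟩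
  simp [simOp]
  ring

variable {V : Type*} [NormedAddCommGroup V] [NormedSpace ℂ V]

/-- The isometry with coefficients `G` takes `v` to the result of applying `C(M)` to the image
of `ψ`. -/
def Simulates (G : Fin 2 × Fin 2 → V →L[ℂ] V) (ψ v : V) (M : Matrix (Fin 2) (Fin 2) ℂ) : Prop :=
  ∀ i, G i v = ∑ j, simOp M i j • G j ψ

namespace Simulates

variable {G : Fin 2 × Fin 2 → V →L[ℂ] V} {ψ v w : V} {M N : Matrix (Fin 2) (Fin 2) ℂ}

theorem add (h : Simulates G ψ v M) (h' : Simulates G ψ w N) :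
    Simulates G ψ (v + w) (M + N) := fun i => by
  simp only [map_add, h i, h' i, simOp_add, Matrix.add_apply, add_smul, Finset.sum_add_distrib]

theorem neg (h : Simulates G ψ v M) : Simulates G ψ (-v) (-M) := fun i => by
  simp only [map_neg, h i, simOp_neg, Matrix.neg_apply, neg_smul, Finset.sum_neg_distrib]

theorem ofReal_smul (r : ℝ) (h : Simulates G ψ v M) :
    Simulates G ψ ((r : ℂ) • v) ((r : ℂ) • M) := fun i => by
  simp only [map_smul, h i, simOp_ofReal_smul, Matrix.smul_apply, smul_assoc, Finset.smul_sum]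

end Simulates

end SimOp

section Physical

variable {HA HB : Type*}
  [NormedAddCommGroup HA] [InnerProductSpace ℂ HA] [CompleteSpace HA]
  [NormedAddCommGroup HB] [InnerProductSpace ℂ HB] [CompleteSpace HB]

namespace Experiment

/-- The coefficients of Alice's isometry. -/
def coeffA (P : Experiment Setting HA HB) : Fin 2 × Fin 2 → HA →L[ℂ] HA :=
  swapCoeff (P.obsA .X) (P.obsA .Y) (P.obsA .Z)

/-- The coefficients of Bob's isometry; the sign of his reference `Y` is undone first. -/
def coeffB (P : Experiment Setting HA HB) : Fin 2 × Fin 2 → HB →L[ℂ] HB :=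
  swapCoeff (P.obsB .X) (-P.obsB .Y) (P.obsB .Z)

theorem leftOp_coeffA (P : Experiment Setting HA HB) (i : Fin 2 × Fin 2) :
    leftOp HA HB (P.coeffA i) = swapCoeff (P.opA .X) (P.opA .Y) (P.opA .Z) i :=
  map_swapCoeff _ _ _ _ i

theorem rightOp_coeffB (P : Experiment Setting HA HB) (j : Fin 2 × Fin 2) :
    rightOp HA HB (P.coeffB j) = swapCoeff (P.opB .X) (-P.opB .Y) (P.opB .Z) j := by
  rw [coeffB, map_swapCoeff, map_neg]
  rfl

theorem norm_obsA_apply (P : Experiment Setting HA HB) (s : Setting) (v : HA) :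
    ‖P.obsA s v‖ = ‖v‖ :=
  norm_apply_of_symmetric_of_sq (P.selfAdjoint_obsA s).isSymmetric (P.sq_obsA s) v

theorem norm_obsB_apply (P : Experiment Setting HA HB) (s : Setting) (v : HB) :
    ‖P.obsB s v‖ = ‖v‖ :=
  norm_apply_of_symmetric_of_sq (P.selfAdjoint_obsB s).isSymmetric (P.sq_obsB s) v

/-- Alice's local isometry. -/
def isometryA (P : Experiment Setting HA HB) :
    HA →ₗᵢ[ℂ] HA ⊗[ℂ] EuclideanSpace ℂ (Fin 2 × Fin 2) :=
  swapIsometry (P.obsA .X) (P.obsA .Y) (P.obsA .Z) (P.norm_obsA_apply _) (P.norm_obsA_apply _)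
    (P.norm_obsA_apply _)

/-- Bob's local isometry. -/
def isometryB (P : Experiment Setting HA HB) :
    HB →ₗᵢ[ℂ] HB ⊗[ℂ] EuclideanSpace ℂ (Fin 2 × Fin 2) :=
  swapIsometry (P.obsB .X) (-P.obsB .Y) (P.obsB .Z) (P.norm_obsB_apply _)
    (fun v => (norm_neg _).trans (P.norm_obsB_apply _ v)) (P.norm_obsB_apply _)

theorem localOp_isometry (P : Experiment Setting HA HB) (v : Bipartite HA HB) :
    localOp P.isometryA.toContinuousLinearMap P.isometryB.toContinuousLinearMap v
      = ∑ i, ∑ j, localOp (attach HA i) (attach HB j)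
          (leftOp HA HB (P.coeffA i) (rightOp HA HB (P.coeffB j) v)) := by
  rw [isometryA, isometryB, swapIsometry_toContinuousLinearMap,
    swapIsometry_toContinuousLinearMap, localOp_sum_sum]
  simp only [localOp_comp, sum_apply, ContinuousLinearMap.comp_apply]
  simp only [← mul_apply_eq_comp, ← localOp_eq_leftOp_mul_rightOp]
  rfl

/-- `f` on Alice's side and `g` on Bob's side act in the same way on the state. -/
def Mirror (P : Experiment Setting HA HB) (f : HA →L[ℂ] HA) (g : HB →L[ℂ] HB) : Prop :=
  leftOp HA HB f P.state = rightOp HA HB g P.state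

namespace Mirror

variable {P : Experiment Setting HA HB} {f f' : HA →L[ℂ] HA} {g g' : HB →L[ℂ] HB}

theorem one : P.Mirror 1 1 := by simp [Mirror]

theorem add (h : P.Mirror f g) (h' : P.Mirror f' g') : P.Mirror (f + f') (g + g') := by
  simp only [Mirror, leftOp_apply, rightOp_apply, localOp_add_left, localOp_add_right,
    add_apply] at *
  rw [h, h']

theorem smul (c : ℂ) (h : P.Mirror f g) : P.Mirror (c • f) (c • g) := by
  simp only [Mirror, leftOp_apply, rightOp_apply, localOp_smul_left, localOp_smul_right,
    smul_apply] at *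
  rw [h]

theorem neg (h : P.Mirror f g) : P.Mirror (-f) (-g) := by
  simpa using h.smul (-1)

/-- Moving a product to the other party reverses the order of the factors. -/
theorem mul (h : P.Mirror f g) (h' : P.Mirror f' g') : P.Mirror (f' * f) (g * g') := by
  simp only [Mirror, map_mul, mul_apply_eq_comp] at *
  rw [← h', h]
  exact DFunLike.congr_fun (leftOp_commute_rightOp f' g) P.state

theorem pow (h : P.Mirror f g) (n : ℕ) : P.Mirror (f ^ n) (g ^ n) := by
  induction n with
  | zero => simpa using one
  | succ n ih => rw [pow_succ, pow_succ']; exact h.mul ih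

theorem outcomeProj (h : P.Mirror f g) (x : ℤˣ) :
    P.Mirror (outcomeProj f x) (outcomeProj g x) :=
  (one.add (h.smul _)).smul _

end Mirror

end Experiment

variable {P : Experiment Setting HA HB}

namespace ReproducesExtMayersYao

theorem mirror (hP : ReproducesExtMayersYao P) (s : Setting) : P.Mirror (P.obsA s) (P.obsB s) :=
  hP.opA_state_eq_opB_state s

theorem rightOp_coeffB_state (hP : ReproducesExtMayersYao P) (j : Fin 2 × Fin 2) :
    rightOp HA HB (P.coeffB j) P.state
      = swapCoeffRev (P.opA .X) (P.opA .Y) (P.opA .Z) j P.state := by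
  have hW := (((hP.mirror .Y).neg.mul (hP.mirror .X)).mul (hP.mirror .Z)).smul Complex.I
  have h := (hW.outcomeProj (outcomeSign j.1)).mul
    (((hP.mirror .X).pow (j.2 : ℕ)).mul ((hP.mirror .Z).outcomeProj (outcomeSign j.2)))
  exact h.symm.trans (DFunLike.congr_fun (map_swapCoeffRev (leftOp HA HB) _ _ _ j) P.state)

/-- The components of the image of the state under the local isometry: only those with equal
registers survive, and they do not depend on the register `Q`. -/
theorem coeff_state (hP : ReproducesExtMayersYao P) (i j : Fin 2 × Fin 2) :
    leftOp HA HB (P.coeffA i) (rightOp HA HB (P.coeffB j) P.state)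
      = if i = j then leftOp HA HB (P.coeffA (i.1, 0)) P.state else 0 := by
  rw [hP.rightOp_coeffB_state, P.leftOp_coeffA, P.leftOp_coeffA,
    hP.pauliOn_opA.swapCoeff_swapCoeffRev]

theorem simulates_opA (hP : ReproducesExtMayersYao P) (s : Setting) :
    Simulates (fun i => leftOp HA HB (P.coeffA i)) P.state (P.opA s P.state) (refObsA s) := by
  have hX : Simulates (fun i => leftOp HA HB (P.coeffA i)) P.state (P.opA .X P.state) pauliX :=
    fun i => by simpa only [P.leftOp_coeffA] using hP.pauliOn_opA.swapCoeff_x i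
  have hY : Simulates (fun i => leftOp HA HB (P.coeffA i)) P.state (P.opA .Y P.state) pauliY :=
    fun i => by simpa only [P.leftOp_coeffA] using hP.pauliOn_opA.swapCoeff_y i
  have hZ : Simulates (fun i => leftOp HA HB (P.coeffA i)) P.state (P.opA .Z P.state) pauliZ :=
    fun i => by simpa only [P.leftOp_coeffA] using hP.pauliOn_opA.swapCoeff_z i
  cases s with
  | X => exact hX
  | Y => exact hY
  | Z => exact hZ
  | D => rw [hP.opA_diagonal isDiagonal_D]; exact (hX.add hZ).ofReal_smul _
  | E => rw [hP.opA_diagonal isDiagonal_E]; exact (hX.add hY).ofReal_smul _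
  | F => rw [hP.opA_diagonal isDiagonal_F]; exact (hY.add hZ).ofReal_smul _

theorem simulates_opB (hP : ReproducesExtMayersYao P) (s : Setting) :
    Simulates (fun j => rightOp HA HB (P.coeffB j)) P.state (P.opB s P.state) (refObsB s) := by
  have hX : Simulates (fun j => rightOp HA HB (P.coeffB j)) P.state (P.opB .X P.state) pauliX :=
    fun j => by simpa only [P.rightOp_coeffB] using hP.pauliOn_opB.swapCoeff_x j
  have hY : Simulates (fun j => rightOp HA HB (P.coeffB j)) P.state (P.opB .Y P.state)
      (-pauliY) := by
    have h : Simulates (fun j => rightOp HA HB (P.coeffB j)) P.state ((-P.opB .Y) P.state) pauliY :=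
      fun j => by simpa only [P.rightOp_coeffB] using hP.pauliOn_opB.swapCoeff_y j
    simpa using h.neg
  have hZ : Simulates (fun j => rightOp HA HB (P.coeffB j)) P.state (P.opB .Z P.state) pauliZ :=
    fun j => by simpa only [P.rightOp_coeffB] using hP.pauliOn_opB.swapCoeff_z j
  cases s with
  | X => exact hX
  | Y => exact hY
  | Z => exact hZ
  | D => rw [hP.opB_diagonal isDiagonal_D]; exact (hX.add hZ).ofReal_smul _
  | E =>
    rw [hP.opB_diagonal isDiagonal_E, refObsB, sub_eq_add_neg]
    exact (hX.add hY).ofReal_smul _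
  | F =>
    rw [hP.opB_diagonal isDiagonal_F, add_comm, refObsB, sub_eq_add_neg]
    exact (hZ.add hY).ofReal_smul _

/-- The weight of the components with `q = 0` in the register `Q`, over both branches. -/
theorem norm_sq_coeff_state_add (hP : ReproducesExtMayersYao P) :
    ‖leftOp HA HB (P.coeffA (0, 0)) P.state‖ ^ 2 + ‖leftOp HA HB (P.coeffA (1, 0)) P.state‖ ^ 2
      = 1 / 2 := by
  have hsum : ∑ i, ‖leftOp HA HB (P.coeffA i) P.state‖ ^ 2 = 1 := by
    simp only [P.leftOp_coeffA]
    rw [sum_norm_sq_swapCoeff (P.norm_opA_apply _) (P.norm_opA_apply _) (P.norm_opA_apply _),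
      P.norm_state, one_pow]
  -- Bob's `X` exchanges the components `q = 0` and `q = 1` of the register `Q`.
  have hflip (p : Fin 2) : leftOp HA HB (P.coeffA (p, 1)) P.state
      = P.opB .X (leftOp HA HB (P.coeffA (p, 0)) P.state) := by
    have h : leftOp HA HB (P.coeffA (p, 0)) (P.opA .X P.state) = _ := hP.simulates_opA .X (p, 0)
    rw [hP.opA_state_eq_opB_state] at h
    refine Eq.trans ?_ (h.symm.trans
      (DFunLike.congr_fun (leftOp_commute_rightOp (P.coeffA (p, 0)) (P.obsB .X)) P.state))
    fin_cases p <;> simp [Fintype.sum_prod_type, simOp, refObsA, pauliX]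
  simp only [Fintype.sum_prod_type, Fin.sum_univ_two, hflip, P.norm_opB_apply] at hsum
  linarith

end ReproducesExtMayersYao

/-! ### Assembling the simulation -/

/-- The local isometry takes `v` to the simulation vector with operator `L` if the state has the
components of the simulation state and `v` has the components that `L` makes of these. -/
theorem localOp_isometry_eq_simVector {R : RefExperiment Setting (Fin 2) (Fin 2)} {α β : ℂ}
    {θ₀ θ₁ : Bipartite HA HB}
    (hψ : ∀ i j, leftOp HA HB (P.coeffA i) (rightOp HA HB (P.coeffB j) P.state)
      = (α * R.branch₀ (i, j)) • θ₀ + (β * R.branch₁ (i, j)) • θ₁)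
    {L : Matrix ((Fin 2 × Fin 2) × (Fin 2 × Fin 2)) ((Fin 2 × Fin 2) × (Fin 2 × Fin 2)) ℂ}
    {v : Bipartite HA HB}
    (hv : ∀ i j, leftOp HA HB (P.coeffA i) (rightOp HA HB (P.coeffB j) v)
      = ∑ k, ∑ l, L (i, j) (k, l) •
          leftOp HA HB (P.coeffA k) (rightOp HA HB (P.coeffB l) P.state)) :
    localOp P.isometryA.toContinuousLinearMap P.isometryB.toContinuousLinearMap v
      = simVector R α β θ₀ θ₁ L := by
  rw [P.localOp_isometry, simVector, junkTensor, junkTensor]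
  simp only [Finset.smul_sum, ← Finset.sum_add_distrib]
  refine Finset.sum_congr rfl fun i _ => Finset.sum_congr rfl fun j _ => ?_
  have : leftOp HA HB (P.coeffA i) (rightOp HA HB (P.coeffB j) v)
      = (α * L.mulVec R.branch₀ (i, j)) • θ₀ + (β * L.mulVec R.branch₁ (i, j)) • θ₁ := by
    rw [hv]
    simp only [hψ, Matrix.mulVec, dotProduct, ← Fintype.sum_prod_type', smul_add,
      Finset.sum_add_distrib, Finset.mul_sum, Finset.sum_smul, smul_smul]
    congr 1 <;> exact Finset.sum_congr rfl fun _ _ => by rw [mul_left_comm]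
  rw [this, map_add, map_smul, map_smul, mul_smul, mul_smul]

/-- A vector is a nonnegative multiple of a unit vector; the unit vector `e` serves for `v = 0`. -/
theorem exists_smul_unit_eq {V : Type*} [NormedAddCommGroup V] [NormedSpace ℂ V] {e : V}
    (he : ‖e‖ = 1) (v : V) : ∃ (c : ℂ) (θ : V), ‖θ‖ = 1 ∧ ‖c‖ = ‖v‖ ∧ c • θ = v := by
  by_cases hv : v = 0
  · exact ⟨0, e, he, by simp [hv], by simp [hv]⟩
  · have hv' : (‖v‖ : ℂ) ≠ 0 := by simpa using hv
    refine ⟨‖v‖, (‖v‖ : ℂ)⁻¹ • v, ?_, by simp, smul_inv_smul₀ hv' v⟩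
    rw [norm_smul, norm_inv, Complex.norm_real, norm_norm, inv_mul_cancel₀ (norm_ne_zero_iff.2 hv)]

end Physical

end SelfTest

end

open SelfTest in
theorem mainTheorem1 {HA HB : Type*}
    [NormedAddCommGroup HA] [InnerProductSpace ℂ HA] [CompleteSpace HA]
    [NormedAddCommGroup HB] [InnerProductSpace ℂ HB] [CompleteSpace HB]
    (P : SelfTest.Experiment SelfTest.Setting HA HB)
    (hP : SelfTest.ReproducesExtMayersYao P) :
    SelfTest.EquivToGeneralSimulation P SelfTest.extMayersYao := by
  -- The amplitude of `|00⟩` in `φ₊` is `1 / √2`, hence the factor `√2` in the branches.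
  obtain ⟨α, θ₀, hθ₀, hα, h₀⟩ :=
    exists_smul_unit_eq P.norm_state ((√2 : ℂ) • leftOp HA HB (P.coeffA (0, 0)) P.state)
  obtain ⟨β, θ₁, hθ₁, hβ, h₁⟩ :=
    exists_smul_unit_eq P.norm_state ((√2 : ℂ) • leftOp HA HB (P.coeffA (1, 0)) P.state)
  have hψ (i j : Fin 2 × Fin 2) :
      leftOp HA HB (P.coeffA i) (rightOp HA HB (P.coeffB j) P.state)
        = (α * extMayersYao.branch₀ (i, j)) • θ₀ + (β * extMayersYao.branch₁ (i, j)) • θ₁ := by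
    rw [hP.coeff_state, mul_comm α, mul_comm β, mul_smul, mul_smul, h₀, h₁]
    obtain ⟨p, q⟩ := i
    obtain ⟨p', q'⟩ := j
    have hc' : (starRingEnd ℂ) ((1 / √2 : ℝ) : ℂ) = ((1 / √2 : ℝ) : ℂ) := Complex.conj_ofReal _
    fin_cases p <;> fin_cases p' <;>
      simp [RefExperiment.branch₀, RefExperiment.branch₁, extMayersYao, phiPlus, -one_div,
        -Complex.ofReal_div, smul_smul, apply_ite (starRingEnd ℂ), hc']
  refine ⟨P.isometryA, P.isometryB, α, β, θ₀, θ₁, ?_, hθ₀, hθ₁, ?_, fun s => ?_, fun s => ?_⟩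
  · have h2 : ‖(√2 : ℂ)‖ ^ 2 = 2 := by
      rw [Complex.norm_real, Real.norm_of_nonneg (Real.sqrt_nonneg 2), Real.sq_sqrt (by norm_num)]
    rw [hα, hβ, norm_smul, norm_smul, mul_pow, mul_pow, h2, ← mul_add,
      hP.norm_sq_coeff_state_add]
    norm_num
  · refine localOp_isometry_eq_simVector hψ fun i j => ?_
    simp [Matrix.one_apply, ite_and]
  · refine localOp_isometry_eq_simVector hψ fun i j => ?_
    change leftOp HA HB (P.coeffA i) (rightOp HA HB (P.coeffB j) (leftOp HA HB (P.obsA s) P.state))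
      = _
    have comm (f : HA →L[ℂ] HA) (v : Bipartite HA HB) :
        leftOp HA HB f (rightOp HA HB (P.coeffB j) v)
          = rightOp HA HB (P.coeffB j) (leftOp HA HB f v) :=
      DFunLike.congr_fun (leftOp_commute_rightOp f (P.coeffB j)) v
    have h : leftOp HA HB (P.coeffA i) (leftOp HA HB (P.obsA s) P.state) = _ :=
      hP.simulates_opA s i
    rw [comm, h, map_sum]
    simp [Matrix.one_apply, comm, extMayersYao]
  · refine localOp_isometry_eq_simVector hψ fun i j => ?_
    change leftOp HA HB (P.coeffA i) (rightOp HA HB (P.coeffB j) (rightOp HA HB (P.obsB s) P.state))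
      = _
    have h : rightOp HA HB (P.coeffB j) (rightOp HA HB (P.obsB s) P.state) = _ :=
      hP.simulates_opB s j
    rw [h, map_sum]
    simp [Matrix.one_apply, extMayersYao]
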